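/- Let $a\in\mathbb R\setminus\{0\}$ and $M>0$ with $|a|<M$, put $\Delta(r)=r^2-2Mr+a^2$, $r_\pm=M\pm\sqrt{M^2-a^2}$, $\rho^2=r^2+a^2\cos^2\theta$. Let $K^*$ be the Kerr-star spacetime, i.e. the manifold $\{(t^*,r)\in\mathbb R^2,\ (\theta,\phi^*)\in S^2\}\setminus\{\rho=0\}$ with the Lorentzian metric (extended smoothly over the axis $\theta\in\{0,\pi\}$) $$\mathbf g=-\Big(1-\frac{2Mr}{\rho^2}\Big)dt^{*2}-\frac{4Mar\sin^2\theta}{\rho^2}\,dt^*d\phi^*+\Big(r^2+a^2+\frac{2Mra^2\sin^2\theta}{\rho^2}\Big)\sin^2\theta\,d\phi^{*2}+2\,dt^*dr-2a\sin^2\theta\,d\phi^*dr+\rho^2d\theta^2 .$$ For a geodesic $\gamma$ of $K^*$ let $E=-\mathbf g(\gamma',\partial_t)$ and $L=\mathbf g(\gamma',\partial_\phi)$, where $\partial_t=\partial_{t^*}$ and $\partial_\phi=\partial_{\phi^*}$, and, off the horizons $\{\Delta=0\}$, let $K=2\rho^2\,\mathbf g(l,\gamma')\,\mathbf g(n,\gamma')+r^2\,\mathbf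 g(\gamma',\gamma')$, where $V=(r^2+a^2)\partial_t+a\partial_\phi$, $\partial_r=\partial_{r}^*+\Delta^{-1}V$ (with $\partial_r^*$ the coordinate field of $r$ in the coordinates $(t^*,r,\theta,\phi^*)$), $l=\Delta^{-1}V+\partial_r$ and $n=\frac{1}{2\rho^2}V-\frac{\Delta}{2\rho^2}\partial_r$; these are constants of motion. **Proposition.** Let $\gamma:[0,+\infty)\to K^*$ be a complete null geodesic ray (an affinely parametrized null geodesic defined on all of $[0,+\infty)$) for which at least one of $E,L,K$ is non-zero. Suppose that the radial coordinate $r(\gamma(s))$, $s\ge 0$, stays in a compact subset of $(0,r_-)$, or that it stays in a compact subset of $(r_+,+\infty)$. Then $\gamma$ is not bounded, i.e. its image is not contained in any compact subset of $K^*$. -/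

import Mathlib

noncomputable section

namespace Kerr

/-- Euclidean three-space, containing the unit sphere `S²`. -/
abbrev E3 : Type := EuclideanSpace ℝ (Fin 3)

/-- The unit sphere `S² ⊆ ℝ³`. -/
abbrev S2 : Type := Metric.sphere (0 : E3) 1

/-- The ambient vector space `ℝ² × ℝ³ ⊇ ℝ² × S²`. Its elements `(t⋆, r, u)` serve as points, and
tangent vectors of `ℝ² × S²` at `(t⋆, r, u)` are the elements `(τ, ϱ, w)` with `w ⟂ u`. On `S²`,
`u = (sin θ cos φ⋆, sin θ sin φ⋆, cos θ)`. -/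
abbrev Amb : Type := ℝ × ℝ × E3

/-- `ρ² = r² + a² cos² θ`. -/
def rhoSq (a : ℝ) (p : Amb) : ℝ := p.2.1 ^ 2 + a ^ 2 * (p.2.2 2) ^ 2

/-- `Δ(r) = r² - 2 M r + a²`. -/
def Delta (a M r : ℝ) : ℝ := r ^ 2 - 2 * M * r + a ^ 2

/-- The inner horizon radius `r₋`. -/
def rMinus (a M : ℝ) : ℝ := M - √(M ^ 2 - a ^ 2)

/-- The outer horizon radius `r₊`. -/
def rPlus (a M : ℝ) : ℝ := M + √(M ^ 2 - a ^ 2)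

/-- Inclusion of `ℝ² × S²` in the ambient vector space. -/
def amb (p : ℝ × ℝ × S2) : Amb := (p.1, p.2.1, (p.2.2 : E3))

/-- The manifold `K⋆ = (ℝ² × S²) \ Σ`, where `Σ = {ρ = 0}` is the ring singularity, with the
subspace topology. -/
abbrev KerrStar (a : ℝ) : Type := {p : ℝ × ℝ × S2 // rhoSq a (amb p) ≠ 0}

/-- The point of the ambient vector space underlying a point of `K⋆`. -/
def KerrStar.pt {a : ℝ} (p : KerrStar a) : Amb := amb p.1

/-- The coordinate function `r` on `K⋆`. -/
def KerrStar.radius {a : ℝ} (p : KerrStar a) : ℝ := p.1.2.1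

/-- The one-form `sin² θ dφ⋆ = x dy - y dx` on `S²`, which is regular on the axis. -/
def beta (p v : Amb) : ℝ := p.2.2 0 * v.2.2 1 - p.2.2 1 * v.2.2 0

/-- The Kerr metric in Kerr-star form,
`-dt⋆² + (2Mr/ρ²)(dt⋆ - a sin²θ dφ⋆)² + a² sin⁴θ dφ⋆² + ρ² dσ² + 2 dt⋆ dr - 2 a sin²θ dφ⋆ dr`,
where `dσ²` is the round metric of `S²`, evaluated on two tangent vectors `v`, `w` at `p`. In this
form it is regular on the axis; see `metric_spherical` for the usual coordinate expression. -/
def metric (a M : ℝ) (p v w : Amb) : ℝ :=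
  -(v.1 * w.1)
    + 2 * M * p.2.1 / rhoSq a p * ((v.1 - a * beta p v) * (w.1 - a * beta p w))
    + a ^ 2 * (beta p v * beta p w)
    + rhoSq a p * inner ℝ v.2.2 w.2.2
    + (v.1 * w.2.1 + v.2.1 * w.1)
    - a * (beta p v * w.2.1 + v.2.1 * beta p w)

/-- The point with Kerr-star coordinates `(t⋆, r, θ, φ⋆)`. -/
def sphPoint (t r θ φ : ℝ) : Amb :=
  (t, r, !₂[Real.sin θ * Real.cos φ, Real.sin θ * Real.sin φ, Real.cos θ])

/-- The tangent vector `τ ∂_t⋆ + ϱ ∂_r⋆ + ϑ ∂_θ + ψ ∂_φ⋆` at the point with Kerr-star coordinates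
`(t⋆, r, θ, φ⋆)`. -/
def sphVec (θ φ τ ϱ ϑ ψ : ℝ) : Amb :=
  (τ, ϱ, !₂[ϑ * (Real.cos θ * Real.cos φ) - ψ * (Real.sin θ * Real.sin φ),
    ϑ * (Real.cos θ * Real.sin φ) + ψ * (Real.sin θ * Real.cos φ), -(ϑ * Real.sin θ)])

/-- The metric in Kerr-star coordinates `(t⋆, r, θ, φ⋆)`. -/
theorem metric_spherical (a M t r θ φ τ ϱ ϑ ψ : ℝ) :
    metric a M (sphPoint t r θ φ) (sphVec θ φ τ ϱ ϑ ψ) (sphVec θ φ τ ϱ ϑ ψ) =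
      -(1 - 2 * M * r / (r ^ 2 + a ^ 2 * Real.cos θ ^ 2)) * τ ^ 2
        - 4 * M * a * r * Real.sin θ ^ 2 / (r ^ 2 + a ^ 2 * Real.cos θ ^ 2) * (τ * ψ)
        + (r ^ 2 + a ^ 2 + 2 * M * r * a ^ 2 * Real.sin θ ^ 2 / (r ^ 2 + a ^ 2 * Real.cos θ ^ 2))
            * Real.sin θ ^ 2 * ψ ^ 2
        + 2 * (τ * ϱ) - 2 * a * Real.sin θ ^ 2 * (ψ * ϱ)
        + (r ^ 2 + a ^ 2 * Real.cos θ ^ 2) * ϑ ^ 2 := by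
  have h1 : beta (sphPoint t r θ φ) (sphVec θ φ τ ϱ ϑ ψ) = Real.sin θ ^ 2 * ψ := by
    simp only [beta, sphPoint, sphVec]
    simp
    linear_combination (Real.sin θ ^ 2 * ψ) * Real.sin_sq_add_cos_sq φ
  have h2 : inner ℝ (sphVec θ φ τ ϱ ϑ ψ).2.2 (sphVec θ φ τ ϱ ϑ ψ).2.2
      = ϑ ^ 2 + Real.sin θ ^ 2 * ψ ^ 2 := by
    simp only [sphVec, PiLp.inner_apply, Fin.sum_univ_three]
    simp [mul_pow, sq_abs]
    linear_combination (ϑ ^ 2 * Real.cos θ ^ 2 + ψ ^ 2 * Real.sin θ ^ 2)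
      * Real.sin_sq_add_cos_sq φ + ϑ ^ 2 * Real.sin_sq_add_cos_sq θ
  have h3 : rhoSq a (sphPoint t r θ φ) = r ^ 2 + a ^ 2 * Real.cos θ ^ 2 := by
    simp [rhoSq, sphPoint]
  rw [metric, h1, h2, h3]
  simp only [sphPoint, sphVec]
  have h4 : Real.cos θ ^ 2 = 1 - Real.sin θ ^ 2 := by
    linear_combination Real.sin_sq_add_cos_sq θ
  linear_combination (a ^ 2 * (Real.sin θ ^ 2 * ψ ^ 2)) * h4

/-! ### Charts, Christoffel symbols, geodesics -/

/-- For `ε = 1` and `ε = -1`, the inverse of stereographic projection from `(0, 0, -ε)`, times the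
identity of `ℝ²`. The two maps parametrize `ℝ² × (S² \ {(0, 0, -ε)})`, hence together cover
`ℝ² × S²`. -/
def param (ε : ℝ) (x : Fin 4 → ℝ) : Amb :=
  (x 0, x 1, !₂[2 * x 2 / (1 + x 2 ^ 2 + x 3 ^ 2), 2 * x 3 / (1 + x 2 ^ 2 + x 3 ^ 2),
    ε * (1 - x 2 ^ 2 - x 3 ^ 2) / (1 + x 2 ^ 2 + x 3 ^ 2)])

/-- The chart inverse to `param ε`; its domain is `{p | 1 + ε * p.2.2 2 ≠ 0}`. -/
def chart (ε : ℝ) (p : Amb) : Fin 4 → ℝ :=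
  ![p.1, p.2.1, p.2.2 0 / (1 + ε * p.2.2 2), p.2.2 1 / (1 + ε * p.2.2 2)]

/-- The matrix `(g_ij)` of the metric in the chart `chart ε`. -/
def metricCoeff (a M ε : ℝ) (x : Fin 4 → ℝ) : Matrix (Fin 4) (Fin 4) ℝ :=
  Matrix.of fun i j => metric a M (param ε x)
    (fderiv ℝ (param ε) x (Pi.single i 1)) (fderiv ℝ (param ε) x (Pi.single j 1))

/-- The partial derivative `∂_l g_ij` in the chart `chart ε`. -/
def dMetricCoeff (a M ε : ℝ) (x : Fin 4 → ℝ) (l i j : Fin 4) : ℝ :=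
  fderiv ℝ (fun y => metricCoeff a M ε y i j) x (Pi.single l 1)

/-- The Christoffel symbol `Γ^k_ij` of the Levi-Civita connection in the chart `chart ε`. -/
def christoffel (a M ε : ℝ) (x : Fin 4 → ℝ) (k i j : Fin 4) : ℝ :=
  1 / 2 * ∑ l, (metricCoeff a M ε x)⁻¹ k l *
    (dMetricCoeff a M ε x i j l + dMetricCoeff a M ε x j i l - dMetricCoeff a M ε x l i j)

/-- `γ` restricted to the (non-degenerate) interval `I` is an (affinely parametrized) geodesic
of `K⋆`: it is `C²`, and at each parameter it satisfies the geodesic equation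
`x''^k + Γ^k_ij x'^i x'^j = 0` in each of the two charts whose domain contains the point.
Derivatives are one-sided at endpoints of `I`. -/
def IsGeodesicOn {a : ℝ} (M : ℝ) (γ : ℝ → KerrStar a) (I : Set ℝ) : Prop :=
  ContDiffOn ℝ 2 (fun s => (γ s).pt) I ∧
  ∀ s ∈ I, ∀ ε ∈ ({1, -1} : Set ℝ), 1 + ε * (γ s).pt.2.2 2 ≠ 0 →
    ∀ k : Fin 4,
      derivWithin (derivWithin (fun s' => chart ε (γ s').pt) I) I s k
        + ∑ i, ∑ j, christoffel a M ε (chart ε (γ s).pt) k i j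
          * derivWithin (fun s' => chart ε (γ s').pt) I s i
          * derivWithin (fun s' => chart ε (γ s').pt) I s j = 0

/-- The velocity `γ'(s)` of a curve in `K⋆` defined on `I`, as a vector of the ambient space. -/
def velocity {a : ℝ} (γ : ℝ → KerrStar a) (I : Set ℝ) (s : ℝ) : Amb :=
  derivWithin (fun s' => (γ s').pt) I s

/-- `γ` is null (lightlike) on `I`. -/
def IsNullOn {a : ℝ} (M : ℝ) (γ : ℝ → KerrStar a) (I : Set ℝ) : Prop :=
  ∀ s ∈ I, velocity γ I s ≠ 0 ∧
    metric a M (γ s).pt (velocity γ I s) (velocity γ I s) = 0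

/-! ### Vector fields and constants of motion -/

/-- The Killing field `∂_t`. -/
def partialT : Amb := (1, 0, 0)

/-- The Killing field `∂_φ`, the infinitesimal rotation about the axis. -/
def partialPhi (p : Amb) : Amb := (0, 0, !₂[-(p.2.2 1), p.2.2 0, 0])

/-- The canonical vector field `V = (r² + a²) ∂_t + a ∂_φ`. -/
def canonV (a : ℝ) (p : Amb) : Amb := (p.2.1 ^ 2 + a ^ 2) • partialT + a • partialPhi p

/-- The Boyer–Lindquist field `∂_r = ∂_r⋆ + Δ⁻¹ V`, where `∂_r⋆` is the Kerr-star coordinate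
field. It lives off the horizons `Δ = 0`. -/
def partialR (a M : ℝ) (p : Amb) : Amb := (0, 1, 0) + (Delta a M p.2.1)⁻¹ • canonV a p

/-- The null field `l = Δ⁻¹ V + ∂_r` (off the horizons). -/
def nullL (a M : ℝ) (p : Amb) : Amb := (Delta a M p.2.1)⁻¹ • canonV a p + partialR a M p

/-- The null field `n = (2ρ²)⁻¹ V - Δ (2ρ²)⁻¹ ∂_r` (off the horizons). -/
def nullN (a M : ℝ) (p : Amb) : Amb :=
  (2 * rhoSq a p)⁻¹ • canonV a p - (Delta a M p.2.1 / (2 * rhoSq a p)) • partialR a M p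

/-- Energy `E = -g(v, ∂_t)` of a tangent vector `v` at `p`. -/
def energy (a M : ℝ) (p v : Amb) : ℝ := -metric a M p v partialT

/-- Angular momentum `L = g(v, ∂_φ)` of a tangent vector `v` at `p`. -/
def angMomentum (a M : ℝ) (p v : Amb) : ℝ := metric a M p v (partialPhi p)

/-- Carter's constant `K = 2 ρ² g(l, v) g(n, v) + r² g(v, v)` of a tangent vector `v` at `p`
(off the horizons). -/
def carterK (a M : ℝ) (p v : Amb) : ℝ :=
  2 * rhoSq a p * metric a M p (nullL a M p) v * metric a M p (nullN a M p) v
    + p.2.1 ^ 2 * metric a M p v v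

/-- `γ` is bounded on `I`: its image lies in a compact subset of `K⋆`. -/
def IsBoundedOn {a : ℝ} (γ : ℝ → KerrStar a) (I : Set ℝ) : Prop :=
  ∃ C : Set (KerrStar a), IsCompact C ∧ ∀ s ∈ I, γ s ∈ C

end Kerr

end

noncomputable section

namespace Kerr

/-! The function `t⋆ - r` is a time function where `r > 0`: the Kerr–Schild form `metric_self_eq`
writes `g(v, v)` as `-σ²`, with `σ` the derivative of `t⋆ - r` along `v`, plus terms that are
non-negative there. For a null vector, `|σ|` therefore controls all the other terms, and on a
compact range of `r` it controls `E` and `L` up to a constant (`exists_energy_angMomentum_le`).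
Along the geodesic `E` and `L` are constant, because `∂_t` and `∂_φ` are Killing fields
(`chart_conservation`). They do not both vanish, since `Δ > 0` on the allowed range of `r` and there
a null vector with `E = L = 0` is zero (`eq_zero_of_energy_angMomentum`). So `|σ|` is bounded below
by a positive constant along the ray, `t⋆ - r` is unbounded on it (`unbounded_of_le_abs_deriv`), and
no compact set contains its image. -/

/-! ### The metric in stereographic charts. -/

/-- The differential of `param ε` at `x`, applied to `v`. -/
def dParam (ε : ℝ) (x v : Fin 4 → ℝ) : Amb :=
  (v 0, v 1, !₂[
    (2 * v 2 * (1 + x 2 ^ 2 + x 3 ^ 2) - 4 * x 2 * (x 2 * v 2 + x 3 * v 3))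
      / (1 + x 2 ^ 2 + x 3 ^ 2) ^ 2,
    (2 * v 3 * (1 + x 2 ^ 2 + x 3 ^ 2) - 4 * x 3 * (x 2 * v 2 + x 3 * v 3))
      / (1 + x 2 ^ 2 + x 3 ^ 2) ^ 2,
    -(4 * ε * (x 2 * v 2 + x 3 * v 3)) / (1 + x 2 ^ 2 + x 3 ^ 2) ^ 2])

theorem conf_ne_zero (x : Fin 4 → ℝ) : 1 + x 2 ^ 2 + x 3 ^ 2 ≠ 0 := by positivity

theorem contDiff_param (ε : ℝ) {n : WithTop ℕ∞} : ContDiff ℝ n (param ε) := by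
  unfold param
  refine ContDiff.prodMk (by fun_prop) (ContDiff.prodMk (by fun_prop) ?_)
  rw [contDiff_euclidean]
  intro i
  fin_cases i <;> simp <;>
    refine ContDiff.div (by fun_prop) (by fun_prop) fun x => conf_ne_zero x

theorem hasDerivAt_param_line (ε : ℝ) (x v : Fin 4 → ℝ) :
    HasDerivAt (fun h : ℝ => param ε (x + h • v)) (dParam ε x v) 0 := by
  have hx : ∀ i, HasDerivAt (fun h : ℝ => (x + h • v) i) (v i) 0 := by
    intro i
    simpa using ((hasDerivAt_id (0 : ℝ)).mul_const (v i)).const_add (x i)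
  have hD : HasDerivAt (fun h : ℝ => 1 + (x + h • v) 2 ^ 2 + (x + h • v) 3 ^ 2)
      (2 * (x 2 * v 2 + x 3 * v 3)) 0 := by
    refine ((((hx 2).pow 2).const_add 1).add ((hx 3).pow 2)).congr_deriv ?_
    simp; ring
  have hN : HasDerivAt (fun h : ℝ => ε * (1 - (x + h • v) 2 ^ 2 - (x + h • v) 3 ^ 2))
      (ε * -(2 * (x 2 * v 2 + x 3 * v 3))) 0 := by
    refine ((((hx 2).pow 2).const_sub 1).sub ((hx 3).pow 2)).const_mul ε |>.congr_deriv ?_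
    simp; ring
  have hne := conf_ne_zero (x + (0 : ℝ) • v)
  unfold param dParam
  refine (hx 0).prodMk ((hx 1).prodMk ?_)
  rw [hasDerivAt_iff_hasFDerivAt, ← hasFDerivWithinAt_univ, hasFDerivWithinAt_euclidean]
  intro i
  rw [hasFDerivWithinAt_univ]
  have key : ∀ (f : ℝ → ℝ) (c : ℝ), HasDerivAt f c 0 → ∀ l : ℝ →L[ℝ] ℝ, l 1 = c →
      HasFDerivAt f l 0 := by
    intro f c hf l hl
    have : l = ContinuousLinearMap.toSpanSingleton ℝ c := by ext; simp [hl]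
    rw [this]; exact hf.hasFDerivAt
  fin_cases i
  · refine key _ _ (((hx 2).const_mul 2).div hD hne) _ ?_
    simp; ring
  · refine key _ _ (((hx 3).const_mul 2).div hD hne) _ ?_
    simp; ring
  · refine key _ _ (hN.div hD hne) _ ?_
    simp; ring

theorem fderiv_param (ε : ℝ) (x v : Fin 4 → ℝ) :
    fderiv ℝ (param ε) x v = dParam ε x v := by
  have h1 : HasFDerivAt (param ε) (fderiv ℝ (param ε) x) (x + (0 : ℝ) • v) := by
    simpa using ((contDiff_param ε (n := 1)).differentiable (by simp) x).hasFDerivAt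
  have h2 : HasDerivAt (fun h : ℝ => x + h • v) v 0 := by
    simpa using ((hasDerivAt_id (0 : ℝ)).smul_const v).const_add x
  have h3 := h1.comp_hasDerivAt (0 : ℝ) h2
  exact HasDerivAt.unique (f := fun h : ℝ => param ε (x + h • v)) h3
    (hasDerivAt_param_line ε x v)

/-- `ρ²` in a stereographic chart. -/
def chartRho (a : ℝ) (x : Fin 4 → ℝ) : ℝ :=
  x 1 ^ 2 + a ^ 2 * ((1 - x 2 ^ 2 - x 3 ^ 2) / (1 + x 2 ^ 2 + x 3 ^ 2)) ^ 2

/-- The one-form `beta` in a stereographic chart. -/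
def chartBeta (x v : Fin 4 → ℝ) : ℝ :=
  4 / (1 + x 2 ^ 2 + x 3 ^ 2) ^ 2 * (x 2 * v 3 - x 3 * v 2)

/-- The metric in a stereographic chart. -/
def chartForm (a M : ℝ) (x v w : Fin 4 → ℝ) : ℝ :=
  -(v 0 * w 0)
    + 2 * M * x 1 / chartRho a x * ((v 0 - a * chartBeta x v) * (w 0 - a * chartBeta x w))
    + a ^ 2 * (chartBeta x v * chartBeta x w)
    + chartRho a x * (4 / (1 + x 2 ^ 2 + x 3 ^ 2) ^ 2 * (v 2 * w 2 + v 3 * w 3))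
    + (v 0 * w 1 + v 1 * w 0)
    - a * (chartBeta x v * w 1 + v 1 * chartBeta x w)

theorem rhoSq_param (a : ℝ) {ε : ℝ} (hε : ε ^ 2 = 1) (x : Fin 4 → ℝ) :
    rhoSq a (param ε x) = chartRho a x := by
  simp only [rhoSq, param, chartRho]
  simp only [Matrix.cons_val]
  rw [mul_div_assoc, mul_pow, hε, one_mul]

theorem beta_dParam (ε : ℝ) (x v : Fin 4 → ℝ) :
    beta (param ε x) (dParam ε x v) = chartBeta x v := by
  have := conf_ne_zero x
  simp only [beta, param, dParam, chartBeta, Matrix.cons_val]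
  field_simp
  ring

theorem inner_dParam {ε : ℝ} (hε : ε ^ 2 = 1) (x v w : Fin 4 → ℝ) :
    inner ℝ (dParam ε x v).2.2 (dParam ε x w).2.2
      = 4 / (1 + x 2 ^ 2 + x 3 ^ 2) ^ 2 * (v 2 * w 2 + v 3 * w 3) := by
  have := conf_ne_zero x
  simp only [dParam, PiLp.inner_apply, Fin.sum_univ_three, RCLike.inner_apply, conj_trivial,
    Matrix.cons_val]
  field_simp
  linear_combination (16 * (x 2 * v 2 + x 3 * v 3) * (x 2 * w 2 + x 3 * w 3)) * hε

/-- The sign `ε` enters only through the third coordinate of the sphere, which the metric sees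
quadratically. Hence a single form `chartForm` serves both charts. -/
theorem metric_dParam (a M : ℝ) {ε : ℝ} (hε : ε ^ 2 = 1) (x v w : Fin 4 → ℝ) :
    metric a M (param ε x) (dParam ε x v) (dParam ε x w) = chartForm a M x v w := by
  rw [metric, beta_dParam, beta_dParam, rhoSq_param a hε, inner_dParam hε]
  rfl

theorem metricCoeff_eq (a M : ℝ) {ε : ℝ} (hε : ε ^ 2 = 1) (x : Fin 4 → ℝ) (i j : Fin 4) :
    metricCoeff a M ε x i j = chartForm a M x (Pi.single i 1) (Pi.single j 1) := by
  simp only [metricCoeff, Matrix.of_apply, fderiv_param, metric_dParam a M hε]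

theorem chartForm_comm (a M : ℝ) (x v w : Fin 4 → ℝ) :
    chartForm a M x v w = chartForm a M x w v := by
  unfold chartForm; ring

theorem chartForm_eq_sum (a M : ℝ) (x v w : Fin 4 → ℝ) :
    chartForm a M x v w =
      ∑ i, ∑ j, chartForm a M x (Pi.single i 1) (Pi.single j 1) * v i * w j := by
  simp [Fin.sum_univ_four, chartForm, chartBeta, Pi.single_apply]
  ring

/-- Pairing with the null field `∂_r⋆` gives `v 0 = a B`, which removes the Kerr–Schild term from
the other pairings. What is left is nearly triangular, with the conformal factor times `ρ²` as the
only pivot to invert. -/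
theorem chartForm_nondegenerate {a : ℝ} (M : ℝ) {x v : Fin 4 → ℝ} (hx : chartRho a x ≠ 0)
    (hv : ∀ i, chartForm a M x (Pi.single i 1) v = 0) : v = 0 := by
  have hD := conf_ne_zero x
  have hμ : chartRho a x * (4 / (1 + x 2 ^ 2 + x 3 ^ 2) ^ 2) ≠ 0 := by positivity
  have h0 := hv 0
  have h1 := hv 1
  have h2 := hv 2
  have h3 := hv 3
  set c := 4 / (1 + x 2 ^ 2 + x 3 ^ 2) ^ 2 with hc
  simp [chartForm, chartBeta, ← hc] at h0 h1 h2 h3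
  set B := c * (x 2 * v 3 - x 3 * v 2) with hB
  have e1 : v 0 - a * B = 0 := by linarith
  rw [e1] at h0 h2 h3
  have e0 : v 1 = v 0 := by linarith
  have e2 : v 2 = 0 := by
    have : chartRho a x * c * v 2 = 0 := by
      linear_combination h2 + (-1) * a * c * x 3 * (e0 + e1)
    simpa [hμ] using this
  have e3 : v 3 = 0 := by
    have : chartRho a x * c * v 3 = 0 := by
      linear_combination h3 + a * c * x 2 * (e0 + e1)
    simpa [hμ] using this
  have hB0 : B = 0 := by rw [hB, e2, e3]; ring
  have e4 : v 0 = 0 := by rw [hB0] at e1; linarith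
  funext i
  fin_cases i
  · exact e4
  · exact e0.trans e4
  · exact e2
  · exact e3

/-- Ensures that the inverse matrix in `christoffel` is a true inverse and not the default value
`0`. -/
theorem isUnit_det_metricCoeff {a : ℝ} (M : ℝ) {ε : ℝ} (hε : ε ^ 2 = 1) {x : Fin 4 → ℝ}
    (hx : chartRho a x ≠ 0) : IsUnit (metricCoeff a M ε x).det := by
  rw [isUnit_iff_ne_zero]
  intro h
  obtain ⟨v, hv0, hv⟩ := Matrix.exists_mulVec_eq_zero_iff.2 h
  refine hv0 (chartForm_nondegenerate M hx fun i => ?_)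
  have := congrFun hv i
  simp only [Matrix.mulVec, dotProduct, metricCoeff_eq a M hε, Pi.zero_apply] at this
  rw [chartForm_eq_sum, Finset.sum_eq_single i (by intro b _ hb; simp [hb]) (by simp)]
  simpa using this

theorem differentiableAt_chartForm {a : ℝ} (M : ℝ) {x : Fin 4 → ℝ} (hx : chartRho a x ≠ 0)
    (v w : Fin 4 → ℝ) : DifferentiableAt ℝ (fun y => chartForm a M y v w) x := by
  have hD := conf_ne_zero x
  have hR : DifferentiableAt ℝ (fun y => chartRho a y) x := by
    unfold chartRho; fun_prop (disch := exact hD)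
  have hB : ∀ v, DifferentiableAt ℝ (fun y => chartBeta y v) x := by
    intro v
    unfold chartBeta; fun_prop (disch := positivity)
  have hc : DifferentiableAt ℝ (fun y : Fin 4 → ℝ => 4 / (1 + y 2 ^ 2 + y 3 ^ 2) ^ 2) x := by
    fun_prop (disch := positivity)
  have hB1 := hB v
  have hB2 := hB w
  unfold chartForm
  fun_prop (disch := assumption)

/-! ### Infinitesimal symmetries of the metric. -/

/-- The rotation field `∂_φ` in a stereographic chart; it is linear. -/
def rotField (v : Fin 4 → ℝ) : Fin 4 → ℝ := ![0, 0, -v 3, v 2]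

/-- The rotation by the angle `α` in a stereographic chart. -/
def chartRot (α : ℝ) (x : Fin 4 → ℝ) : Fin 4 → ℝ :=
  ![x 0, x 1, Real.cos α * x 2 - Real.sin α * x 3, Real.sin α * x 2 + Real.cos α * x 3]

theorem chartRot_normSq (α : ℝ) (x : Fin 4 → ℝ) :
    (chartRot α x) 2 ^ 2 + (chartRot α x) 3 ^ 2 = x 2 ^ 2 + x 3 ^ 2 := by
  simp only [chartRot, Matrix.cons_val]
  linear_combination (x 2 ^ 2 + x 3 ^ 2) * Real.sin_sq_add_cos_sq α

theorem chartRot_conf (α : ℝ) (x : Fin 4 → ℝ) :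
    1 + (chartRot α x) 2 ^ 2 + (chartRot α x) 3 ^ 2 = 1 + x 2 ^ 2 + x 3 ^ 2 := by
  linear_combination chartRot_normSq α x

/-- Rotations about the axis are isometries and act linearly in the chart. Moving the rotation from
the base point to the vectors leaves an expression whose `α`-derivative needs no derivative of the
metric coefficients. -/
theorem chartForm_chartRot (a M α : ℝ) (x v w : Fin 4 → ℝ) :
    chartForm a M (chartRot α x) v w = chartForm a M x (chartRot (-α) v) (chartRot (-α) w) := by
  have hB : ∀ v, chartBeta (chartRot α x) v = chartBeta x (chartRot (-α) v) := by
    intro v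
    simp only [chartBeta, chartRot_conf]
    simp only [chartRot, Matrix.cons_val, Real.cos_neg, Real.sin_neg]
    ring
  have hR : chartRho a (chartRot α x) = chartRho a x := by
    have : 1 - (chartRot α x) 2 ^ 2 - (chartRot α x) 3 ^ 2 = 1 - x 2 ^ 2 - x 3 ^ 2 := by
      linear_combination -chartRot_normSq α x
    simp only [chartRho, chartRot_conf, this]
    simp [chartRot]
  have hI : (chartRot (-α) v) 2 * (chartRot (-α) w) 2 + (chartRot (-α) v) 3 * (chartRot (-α) w) 3
      = v 2 * w 2 + v 3 * w 3 := by
    simp only [chartRot, Matrix.cons_val, Real.cos_neg, Real.sin_neg]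
    linear_combination (v 2 * w 2 + v 3 * w 3) * Real.sin_sq_add_cos_sq α
  have h1 : (chartRot α x) 1 = x 1 := by simp [chartRot]
  simp only [chartForm, hB, hR, hI, chartRot_conf, h1]
  simp [chartRot]

theorem hasDerivAt_chartRot (x : Fin 4 → ℝ) :
    HasDerivAt (fun α => chartRot α x) (rotField x) 0 := by
  have hc : HasDerivAt Real.cos 0 0 := by simpa using Real.hasDerivAt_cos 0
  have hs : HasDerivAt Real.sin 1 0 := by simpa using Real.hasDerivAt_sin 0
  rw [hasDerivAt_pi]
  intro i
  fin_cases i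
  · exact hasDerivAt_const _ _
  · exact hasDerivAt_const _ _
  · refine ((hc.mul_const (x 2)).sub (hs.mul_const (x 3))).congr_deriv ?_
    simp [rotField]
  · refine ((hs.mul_const (x 2)).add (hc.mul_const (x 3))).congr_deriv ?_
    simp [rotField]

/-- The Killing equation for `∂_φ`, found by differentiating the isometry identity at `α = 0`. As
the field is linear, its derivative in direction `v` is `rotField v`. -/
theorem fderiv_chartForm_rotField {a : ℝ} (M : ℝ) {x : Fin 4 → ℝ} (hx : chartRho a x ≠ 0)
    (v : Fin 4 → ℝ) :
    fderiv ℝ (fun y => chartForm a M y v v) x (rotField x)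
      + 2 * chartForm a M x (rotField v) v = 0 := by
  have h0 : chartRot 0 x = x := by
    funext i; fin_cases i <;> simp [chartRot]
  have h1 : HasFDerivAt (fun y => chartForm a M y v v)
      (fderiv ℝ (fun y => chartForm a M y v v) x) (chartRot 0 x) := by
    rw [h0]; exact (differentiableAt_chartForm M hx v v).hasFDerivAt
  have h2 := h1.comp_hasDerivAt (0 : ℝ) (hasDerivAt_chartRot x)
  have h3 : HasDerivAt (fun α => chartRot (-α) v) (-rotField v) 0 := by
    have h := hasDerivAt_chartRot v
    rw [← neg_zero] at h
    simpa [Function.comp_def] using h.scomp (0 : ℝ) (hasDerivAt_neg (0 : ℝ))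
  have h4 := hasDerivAt_pi.1 h3
  have h5 : HasDerivAt (fun α => chartBeta x (chartRot (-α) v)) (-chartBeta x (rotField v)) 0 := by
    refine ((((h4 3).const_mul (x 2)).sub ((h4 2).const_mul (x 3))).const_mul
      (4 / (1 + x 2 ^ 2 + x 3 ^ 2) ^ 2)).congr_deriv ?_
    simp only [chartBeta, Pi.neg_apply]; ring
  have hx0 := ((h4 0).sub (h5.const_mul a))
  have h6 : HasDerivAt (fun α => chartForm a M x (chartRot (-α) v) (chartRot (-α) v))
      (-(2 * chartForm a M x (rotField v) v)) 0 := by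
    refine ((((((h4 0).mul (h4 0)).neg.add ((hx0.mul hx0).const_mul
      (2 * M * x 1 / chartRho a x))).add ((h5.mul h5).const_mul (a ^ 2))).add
      (((((h4 2).mul (h4 2)).add ((h4 3).mul (h4 3))).const_mul
        (4 / (1 + x 2 ^ 2 + x 3 ^ 2) ^ 2)).const_mul (chartRho a x))).add
      (((h4 0).mul (h4 1)).add ((h4 1).mul (h4 0)))).sub
      (((h5.mul (h4 1)).add ((h4 1).mul h5)).const_mul a) |>.congr_deriv ?_
    have hv : chartRot (-0) v = v := by
      funext i; fin_cases i <;> simp [chartRot]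
    simp only [hv, chartForm, Pi.neg_apply, Pi.sub_apply]
    ring
  have h7 := HasDerivAt.unique (f := fun α => chartForm a M (chartRot α x) v v) h2
    (by simpa only [chartForm_chartRot] using h6)
  rw [h7]; ring

theorem fderiv_chartForm_time {a : ℝ} (M : ℝ) {x : Fin 4 → ℝ} (hx : chartRho a x ≠ 0)
    (v : Fin 4 → ℝ) :
    fderiv ℝ (fun y => chartForm a M y v v) x (Pi.single 0 1) = 0 := by
  have h1 : HasFDerivAt (fun y => chartForm a M y v v)
      (fderiv ℝ (fun y => chartForm a M y v v) x) (x + (0 : ℝ) • Pi.single 0 1) := by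
    simpa using (differentiableAt_chartForm M hx v v).hasFDerivAt
  have h2 : HasDerivAt (fun h : ℝ => x + h • (Pi.single 0 1 : Fin 4 → ℝ)) (Pi.single 0 1) 0 := by
    simpa using ((hasDerivAt_id (0 : ℝ)).smul_const (Pi.single 0 1 : Fin 4 → ℝ)).const_add x
  have h3 := h1.comp_hasDerivAt (0 : ℝ) h2
  refine HasDerivAt.unique
    (f := fun h : ℝ => chartForm a M (x + h • (Pi.single 0 1 : Fin 4 → ℝ)) v v) h3 ?_
  have : (fun h : ℝ => chartForm a M (x + h • (Pi.single 0 1 : Fin 4 → ℝ)) v v)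
      = fun _ => chartForm a M x v v := by
    funext h
    simp [chartForm, chartBeta, chartRho]
  rw [this]
  exact hasDerivAt_const _ _

/-! ### The geodesic equation and Noether's conservation law. -/

theorem dMetricCoeff_eq (a M : ℝ) {ε : ℝ} (hε : ε ^ 2 = 1) (x : Fin 4 → ℝ) (l i j : Fin 4) :
    dMetricCoeff a M ε x l i j =
      fderiv ℝ (fun y => chartForm a M y (Pi.single i 1) (Pi.single j 1)) x (Pi.single l 1) := by
  simp only [dMetricCoeff, metricCoeff_eq a M hε]

theorem dMetricCoeff_comm (a M : ℝ) {ε : ℝ} (hε : ε ^ 2 = 1) (x : Fin 4 → ℝ) (l i j : Fin 4) :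
    dMetricCoeff a M ε x l i j = dMetricCoeff a M ε x l j i := by
  rw [dMetricCoeff_eq a M hε, dMetricCoeff_eq a M hε]
  congr 2
  funext y
  exact chartForm_comm a M y _ _

theorem fderiv_chartForm_single (a M : ℝ) {ε : ℝ} (hε : ε ^ 2 = 1) (x : Fin 4 → ℝ)
    (i j : Fin 4) (X : Fin 4 → ℝ) :
    fderiv ℝ (fun y => chartForm a M y (Pi.single i 1) (Pi.single j 1)) x X
      = ∑ l, dMetricCoeff a M ε x l i j * X l := by
  conv_lhs => rw [pi_eq_sum_univ' X]
  simp only [map_sum, map_smul, smul_eq_mul, dMetricCoeff_eq a M hε]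
  exact Finset.sum_congr rfl fun l _ => mul_comm _ _

theorem fderiv_chartForm (a M : ℝ) {ε : ℝ} (hε : ε ^ 2 = 1) {x : Fin 4 → ℝ}
    (hx : chartRho a x ≠ 0) (v X : Fin 4 → ℝ) :
    fderiv ℝ (fun y => chartForm a M y v v) x X
      = ∑ i, ∑ j, (∑ l, dMetricCoeff a M ε x l i j * X l) * v i * v j := by
  have h : HasFDerivAt (fun y => chartForm a M y v v) (∑ i, ∑ j, v j • v i •
      fderiv ℝ (fun y => chartForm a M y (Pi.single i 1) (Pi.single j 1)) x) x := by
    have : (fun y => chartForm a M y v v) = fun y => ∑ i, ∑ j,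
        chartForm a M y (Pi.single i 1) (Pi.single j 1) * v i * v j := by
      funext y; exact chartForm_eq_sum a M y v v
    rw [this]
    exact HasFDerivAt.fun_sum fun i _ => HasFDerivAt.fun_sum fun j _ =>
      ((differentiableAt_chartForm M hx _ _).hasFDerivAt.mul_const _).mul_const _
  rw [h.fderiv]
  simp only [_root_.sum_apply, _root_.smul_apply, smul_eq_mul,
    fderiv_chartForm_single a M hε]
  refine Finset.sum_congr rfl fun i _ => Finset.sum_congr rfl fun j _ => ?_
  ring

/-- The geodesic equation with lowered index. -/
theorem lowered_geodesic {a : ℝ} (M : ℝ) {ε : ℝ} (hε : ε ^ 2 = 1) {x v A : Fin 4 → ℝ}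
    (hx : chartRho a x ≠ 0)
    (geo : ∀ k, A k + ∑ i, ∑ j, christoffel a M ε x k i j * v i * v j = 0) (m : Fin 4) :
    ∑ k, metricCoeff a M ε x m k * A k = -(1 / 2 * ∑ i, ∑ j, (dMetricCoeff a M ε x i j m
      + dMetricCoeff a M ε x j i m - dMetricCoeff a M ε x m i j) * v i * v j) := by
  set z : Fin 4 → ℝ := fun m => 1 / 2 * ∑ i, ∑ j, (dMetricCoeff a M ε x i j m
      + dMetricCoeff a M ε x j i m - dMetricCoeff a M ε x m i j) * v i * v j with hz
  have hA : A = -((metricCoeff a M ε x)⁻¹.mulVec z) := by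
    funext k
    have := geo k
    have e : ∑ i, ∑ j, christoffel a M ε x k i j * v i * v j
        = ((metricCoeff a M ε x)⁻¹.mulVec z) k := by
      simp only [christoffel, Matrix.mulVec, dotProduct, hz, Fin.sum_univ_four]
      ring
    rw [e] at this
    simp only [Pi.neg_apply]
    linarith
  have h := isUnit_det_metricCoeff M hε hx
  have : (metricCoeff a M ε x).mulVec A = -z := by
    rw [hA, Matrix.mulVec_neg, Matrix.mulVec_mulVec, Matrix.mul_nonsing_inv _ h,
      Matrix.one_mulVec]
  exact congrFun this m

/-- Noether's argument: by the geodesic equation the derivative of `g(X, v)` is `½ (∂_X g)(v, v) +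
g(Y, v)`, which is half the left side of `kill`. The Killing equation is thus needed only at the
velocity, with `Y` the derivative of `X` along the curve. -/
theorem chart_conservation {a : ℝ} (M : ℝ) {ε : ℝ} (hε : ε ^ 2 = 1) {S : Set ℝ} {s : ℝ}
    {x v X : ℝ → Fin 4 → ℝ} {A Y : Fin 4 → ℝ} (hρ : chartRho a (x s) ≠ 0)
    (hx : HasDerivWithinAt x (v s) S s) (hv : HasDerivWithinAt v A S s)
    (hX : HasDerivWithinAt X Y S s)
    (geo : ∀ k, A k + ∑ i, ∑ j, christoffel a M ε (x s) k i j * v s i * v s j = 0)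
    (kill : fderiv ℝ (fun y => chartForm a M y (v s) (v s)) (x s) (X s)
      + 2 * chartForm a M (x s) Y (v s) = 0) :
    HasDerivWithinAt (fun t => chartForm a M (x t) (X t) (v t)) 0 S s := by
  have h1 : (fun t => chartForm a M (x t) (X t) (v t)) = fun t => ∑ i, ∑ j,
      chartForm a M (x t) (Pi.single i 1) (Pi.single j 1) * X t i * v t j := by
    funext t; exact chartForm_eq_sum a M _ _ _
  rw [h1]
  have hvi := hasDerivWithinAt_pi.1 hv
  have hXi := hasDerivWithinAt_pi.1 hX
  refine (HasDerivWithinAt.fun_sum fun i _ => HasDerivWithinAt.fun_sum fun j _ =>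
    (((differentiableAt_chartForm M hρ (Pi.single i 1) (Pi.single j 1)).hasFDerivAt.comp_hasDerivWithinAt
      s hx).mul (hXi i)).mul (hvi j)).congr_deriv ?_
  have low := lowered_geodesic M hε hρ geo
  rw [fderiv_chartForm a M hε hρ, chartForm_eq_sum] at kill
  simp only [Pi.mul_apply, Function.comp_apply, fderiv_chartForm_single a M hε]
  simp only [← metricCoeff_eq a M hε] at kill ⊢
  have sym := dMetricCoeff_comm a M hε (x s)
  generalize dMetricCoeff a M ε (x s) = d at *
  generalize (metricCoeff a M ε (x s) : Fin 4 → Fin 4 → ℝ) = G at *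
  -- The Euler–Lagrange form `(g_ij v^j)' = ½ ∂_i g_jk v^j v^k`: contracted with `v v`, two of the
  -- three Christoffel terms coincide and cancel the derivative of `g_ij`.
  have half : ∀ i, ∑ j, ((∑ l, d l i j * v s l) * v s j + G i j * A j)
      = 1 / 2 * ∑ j, ∑ k, d i j k * v s j * v s k := by
    intro i
    rw [Finset.sum_add_distrib, low]
    have e : ∀ j k, d j k i = d j i k := fun j k => sym j k i
    simp only [e, Fin.sum_univ_four]
    ring
  have split : ∑ i, ∑ j, ((((∑ l, d l i j * v s l) * X s i + G i j * Y i) * v s j)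
      + G i j * X s i * A j) = ∑ i, X s i * ∑ j, ((∑ l, d l i j * v s l) * v s j + G i j * A j)
        + ∑ i, ∑ j, G i j * Y i * v s j := by
    simp only [Finset.mul_sum, ← Finset.sum_add_distrib]
    refine Finset.sum_congr rfl fun i _ => Finset.sum_congr rfl fun j _ => ?_
    ring
  rw [split]
  simp only [half]
  have swap : ∑ i, X s i * (1 / 2 * ∑ j, ∑ k, d i j k * v s j * v s k)
      = 1 / 2 * ∑ i, ∑ j, (∑ l, d l i j * X s l) * v s i * v s j := by
    simp only [Finset.mul_sum, Finset.sum_mul]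
    rw [Finset.sum_comm]
    refine Finset.sum_congr rfl fun i _ => ?_
    rw [Finset.sum_comm]
    refine Finset.sum_congr rfl fun j _ => Finset.sum_congr rfl fun l _ => ?_
    ring
  rw [swap]
  linarith

/-! ### From the charts to conserved quantities on the manifold. -/

theorem sphere_sq_sum {a : ℝ} (p : KerrStar a) :
    p.pt.2.2 0 ^ 2 + p.pt.2.2 1 ^ 2 + p.pt.2.2 2 ^ 2 = 1 := by
  have h : ‖(p.1.2.2 : E3)‖ = 1 := norm_eq_of_mem_sphere p.1.2.2
  have h2 := EuclideanSpace.norm_sq_eq (p.1.2.2 : E3)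
  rw [h, Fin.sum_univ_three] at h2
  simp only [Real.norm_eq_abs, sq_abs] at h2
  simp only [KerrStar.pt, amb]
  linarith

/-- The sphere equation turns the conformal factor `1 + x₂² + x₃²` into `2 / (1 + ε u₂)`. -/
theorem param_chart {ε : ℝ} (hε : ε ^ 2 = 1) {p : Amb}
    (hp : p.2.2 0 ^ 2 + p.2.2 1 ^ 2 + p.2.2 2 ^ 2 = 1) (hd : 1 + ε * p.2.2 2 ≠ 0) :
    param ε (chart ε p) = p := by
  have hN : 1 + (p.2.2 0 / (1 + ε * p.2.2 2)) ^ 2 + (p.2.2 1 / (1 + ε * p.2.2 2)) ^ 2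
      = 2 / (1 + ε * p.2.2 2) := by
    field_simp
    linear_combination hp + (p.2.2 2) ^ 2 * hε
  have hN' : 1 - (p.2.2 0 / (1 + ε * p.2.2 2)) ^ 2 - (p.2.2 1 / (1 + ε * p.2.2 2)) ^ 2
      = 2 * ε * p.2.2 2 / (1 + ε * p.2.2 2) := by
    field_simp
    linear_combination -hp - (p.2.2 2) ^ 2 * hε
  refine Prod.ext ?_ (Prod.ext ?_ ?_)
  · simp [param, chart]
  · simp [param, chart]
  · ext i
    simp only [param, chart, Matrix.cons_val]
    rw [hN, hN']
    fin_cases i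
    · simp; field_simp
    · simp; field_simp
    · simp; field_simp; linear_combination p.2.2 2 * hε

theorem contDiffAt_chart {ε : ℝ} {p : Amb} (hd : 1 + ε * p.2.2 2 ≠ 0) {n : WithTop ℕ∞} :
    ContDiffAt ℝ n (chart ε) p := by
  rw [contDiffAt_pi]
  have h : ∀ i, ContDiffAt ℝ n (fun q : Amb => q.2.2 i) p := fun i => by fun_prop
  intro i
  fin_cases i
  · exact contDiffAt_fst
  · exact contDiffAt_fst.comp p contDiffAt_snd
  · exact (h 0).div (contDiffAt_const.add (contDiffAt_const.mul (h 2))) hd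
  · exact (h 1).div (contDiffAt_const.add (contDiffAt_const.mul (h 2))) hd

theorem dParam_time (ε : ℝ) (x : Fin 4 → ℝ) : dParam ε x (Pi.single 0 1) = partialT := by
  refine Prod.ext ?_ (Prod.ext ?_ ?_)
  · simp [dParam, partialT]
  · simp [dParam, partialT]
  · ext i; fin_cases i <;> simp [dParam, partialT]

theorem dParam_rotField (ε : ℝ) (x : Fin 4 → ℝ) :
    dParam ε x (rotField x) = partialPhi (param ε x) := by
  have := conf_ne_zero x
  refine Prod.ext ?_ (Prod.ext ?_ ?_)
  · simp [dParam, partialPhi, rotField]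
  · simp [dParam, partialPhi, rotField]
  · ext i
    fin_cases i
    · simp [dParam, partialPhi, rotField, param]; field_simp; ring
    · simp [dParam, partialPhi, rotField, param]; field_simp; ring
    · simp [dParam, partialPhi, rotField]; left; right; ring

open Filter Topology in
/-- Near each parameter, a geodesic is represented in one of the two stereographic charts. -/
theorem IsGeodesicOn.exists_chart {a M : ℝ} {γ : ℝ → KerrStar a} {I : Set ℝ}
    (hI : UniqueDiffOn ℝ I) (h : IsGeodesicOn M γ I) {s : ℝ} (hs : s ∈ I) :
    ∃ (ε : ℝ) (x v : ℝ → Fin 4 → ℝ) (A : Fin 4 → ℝ), ε ^ 2 = 1 ∧ chartRho a (x s) ≠ 0 ∧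
      HasDerivWithinAt x (v s) I s ∧ HasDerivWithinAt v A I s ∧
      (∀ k, A k + ∑ i, ∑ j, christoffel a M ε (x s) k i j * v s i * v s j = 0) ∧
      ∀ᶠ t in 𝓝[I] s, (γ t).pt = param ε (x t) ∧ velocity γ I t = dParam ε (x t) (v t) := by
  obtain ⟨ε, hεm, hd⟩ : ∃ ε ∈ ({1, -1} : Set ℝ), 1 + ε * (γ s).pt.2.2 2 ≠ 0 := by
    by_cases h1 : 1 + 1 * (γ s).pt.2.2 2 = 0
    · exact ⟨-1, by simp, by intro h2; linarith⟩
    · exact ⟨1, by simp, h1⟩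
  have hε : ε ^ 2 = 1 := by rcases hεm with h | h <;> rw [h] <;> norm_num
  have hgood : ∀ t ∈ I, 1 + ε * (γ t).pt.2.2 2 ≠ 0 →
      ContDiffWithinAt ℝ 2 (fun s' => chart ε (γ s').pt) I t := fun t ht htd =>
    ContDiffAt.comp_contDiffWithinAt (g := chart ε) (f := fun s' => (γ s').pt) t
      (contDiffAt_chart htd) (h.1 t ht)
  have hdiff : ∀ t ∈ I, 1 + ε * (γ t).pt.2.2 2 ≠ 0 →
      HasDerivWithinAt (fun s' => chart ε (γ s').pt)
        (derivWithin (fun s' => chart ε (γ s').pt) I t) I t := fun t ht htd =>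
    ((hgood t ht htd).differentiableWithinAt (by norm_num)).hasDerivWithinAt
  have hev : ∀ t ∈ I, 1 + ε * (γ t).pt.2.2 2 ≠ 0 →
      ∀ᶠ t' in 𝓝[I] t, t' ∈ I ∧ 1 + ε * (γ t').pt.2.2 2 ≠ 0 := by
    intro t ht htd
    have hc : ContinuousWithinAt (fun t' => 1 + ε * (γ t').pt.2.2 2) I t := by
      have : Continuous fun q : Amb => 1 + ε * q.2.2 2 := by fun_prop
      exact this.continuousAt.comp_continuousWithinAt (h.1.continuousOn t ht)
    exact eventually_mem_nhdsWithin.and (hc.eventually_ne htd)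
  refine ⟨ε, fun t => chart ε (γ t).pt, derivWithin (fun s' => chart ε (γ s').pt) I,
    derivWithin (derivWithin (fun s' => chart ε (γ s').pt) I) I s, hε, ?_, hdiff s hs hd, ?_,
    h.2 s hs ε hεm hd, ?_⟩
  · rw [← rhoSq_param a hε, param_chart hε (sphere_sq_sum _) hd]
    exact (γ s).2
  · have h2 : ContDiffWithinAt ℝ 1 (fderivWithin ℝ (fun s' => chart ε (γ s').pt) I) I s :=
      (hgood s hs hd).fderivWithin_right hI (by norm_num) hs
    have h3 : DifferentiableWithinAt ℝ (derivWithin (fun s' => chart ε (γ s').pt) I) I s :=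
      (h2.differentiableWithinAt (by norm_num)).clm_apply (differentiableWithinAt_const 1)
    exact h3.hasDerivWithinAt
  · filter_upwards [hev s hs hd] with t ⟨ht, htd⟩
    refine ⟨(param_chart hε (sphere_sq_sum _) htd).symm, ?_⟩
    have h1 : HasFDerivAt (param ε) (fderiv ℝ (param ε) (chart ε (γ t).pt)) (chart ε (γ t).pt) :=
      ((contDiff_param ε (n := 1)).differentiable (by simp) _).hasFDerivAt
    have h2 := h1.comp_hasDerivWithinAt t (hdiff t ht htd)
    rw [fderiv_param] at h2
    refine HasDerivWithinAt.derivWithin ?_ (hI t ht)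
    refine h2.congr_of_eventuallyEq ?_ (param_chart hε (sphere_sq_sum _) htd).symm
    filter_upwards [hev t ht htd] with t' ht'
    exact (param_chart hε (sphere_sq_sum _) ht'.2).symm

theorem IsGeodesicOn.hasDerivWithinAt_energy {a M : ℝ} {γ : ℝ → KerrStar a} {I : Set ℝ}
    (hI : UniqueDiffOn ℝ I) (h : IsGeodesicOn M γ I) {s : ℝ} (hs : s ∈ I) :
    HasDerivWithinAt (fun t => energy a M (γ t).pt (velocity γ I t)) 0 I s := by
  obtain ⟨ε, x, v, A, hε, hρ, hx, hv, geo, hev⟩ := h.exists_chart hI hs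
  have key := (chart_conservation M hε hρ hx hv
    (hasDerivWithinAt_const s I (Pi.single 0 1 : Fin 4 → ℝ)) geo (by
      rw [fderiv_chartForm_time M hρ]; simp [chartForm, chartBeta])).neg
  rw [neg_zero] at key
  have heq : ∀ t, (γ t).pt = param ε (x t) ∧ velocity γ I t = dParam ε (x t) (v t) →
      energy a M (γ t).pt (velocity γ I t) = -chartForm a M (x t) (Pi.single 0 1) (v t) := by
    rintro t ⟨h1, h2⟩
    rw [h1, h2, energy, ← dParam_time ε (x t), metric_dParam a M hε, chartForm_comm]
  exact key.congr_of_eventuallyEq (hev.mono heq) (heq s (hev.self_of_nhdsWithin hs))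

theorem IsGeodesicOn.hasDerivWithinAt_angMomentum {a M : ℝ} {γ : ℝ → KerrStar a} {I : Set ℝ}
    (hI : UniqueDiffOn ℝ I) (h : IsGeodesicOn M γ I) {s : ℝ} (hs : s ∈ I) :
    HasDerivWithinAt (fun t => angMomentum a M (γ t).pt (velocity γ I t)) 0 I s := by
  obtain ⟨ε, x, v, A, hε, hρ, hx, hv, geo, hev⟩ := h.exists_chart hI hs
  have hX : HasDerivWithinAt (fun t => rotField (x t)) (rotField (v s)) I s := by
    have hxi := hasDerivWithinAt_pi.1 hx
    rw [hasDerivWithinAt_pi]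
    intro i
    fin_cases i
    · exact hasDerivWithinAt_const _ _ _
    · exact hasDerivWithinAt_const _ _ _
    · exact (hxi 3).neg
    · exact hxi 2
  have key := chart_conservation M hε hρ hx hv hX geo (fderiv_chartForm_rotField M hρ (v s))
  have heq : ∀ t, (γ t).pt = param ε (x t) ∧ velocity γ I t = dParam ε (x t) (v t) →
      angMomentum a M (γ t).pt (velocity γ I t)
        = chartForm a M (x t) (rotField (x t)) (v t) := by
    rintro t ⟨h1, h2⟩
    rw [h1, h2, angMomentum, ← dParam_rotField ε (x t), metric_dParam a M hε, chartForm_comm]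
  exact key.congr_of_eventuallyEq (hev.mono heq) (heq s (hev.self_of_nhdsWithin hs))

theorem eq_zero_of_hasDerivWithinAt_zero {f : ℝ → ℝ}
    (h : ∀ s ∈ Set.Ici (0 : ℝ), HasDerivWithinAt f 0 (Set.Ici 0) s) {s : ℝ}
    (hs : s ∈ Set.Ici (0 : ℝ)) : f s = f 0 := by
  refine constant_of_has_deriv_right_zero (a := 0) (b := s) ?_ ?_ s ⟨hs, le_rfl⟩
  · exact fun t ht => ((h t ht.1).continuousWithinAt).mono fun y hy => hy.1
  · exact fun t ht => (h t ht.1).mono (Set.Ici_subset_Ici.2 ht.1)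

/-! ### Pointwise estimates for null vectors. -/

theorem inner_self_E3 (w : E3) : inner ℝ w w = w 0 ^ 2 + w 1 ^ 2 + w 2 ^ 2 := by
  rw [real_inner_self_eq_norm_sq, EuclideanSpace.norm_sq_eq, Fin.sum_univ_three]
  simp

/-- The Kerr–Schild form of the metric. -/
theorem metric_self_eq (a M : ℝ) (p v : Amb) :
    metric a M p v v = -(v.1 - v.2.1) ^ 2 + (v.2.1 - a * beta p v) ^ 2
      + 2 * M * p.2.1 / rhoSq a p * (v.1 - a * beta p v) ^ 2
      + rhoSq a p * (v.2.2 0 ^ 2 + v.2.2 1 ^ 2 + v.2.2 2 ^ 2) := by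
  rw [metric, inner_self_E3]; ring

theorem energy_eq (a M : ℝ) (p v : Amb) :
    energy a M p v = v.1 - v.2.1 - 2 * M * p.2.1 / rhoSq a p * (v.1 - a * beta p v) := by
  have hb : beta p partialT = 0 := by simp [beta, partialT]
  rw [energy, metric, hb]
  simp [partialT]; ring

theorem angMomentum_eq (a M : ℝ) (p v : Amb) :
    angMomentum a M p v = rhoSq a p * beta p v - a * (p.2.2 0 ^ 2 + p.2.2 1 ^ 2) *
      (v.2.1 - a * beta p v + 2 * M * p.2.1 / rhoSq a p * (v.1 - a * beta p v)) := by
  have hb : beta p (partialPhi p) = p.2.2 0 ^ 2 + p.2.2 1 ^ 2 := by simp [beta, partialPhi]; ring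
  have hi : inner ℝ v.2.2 (partialPhi p).2.2 = beta p v := by
    simp [partialPhi, PiLp.inner_apply, Fin.sum_univ_three, beta]; ring
  rw [angMomentum, metric, hb, hi]
  simp [partialPhi]; ring

/-- Cauchy–Schwarz in the plane orthogonal to the axis. -/
theorem beta_sq_le (p v : Amb) :
    beta p v ^ 2 ≤ (p.2.2 0 ^ 2 + p.2.2 1 ^ 2) * (v.2.2 0 ^ 2 + v.2.2 1 ^ 2 + v.2.2 2 ^ 2) := by
  unfold beta
  nlinarith [sq_nonneg (p.2.2 0 * v.2.2 0 + p.2.2 1 * v.2.2 1),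
    mul_nonneg (add_nonneg (sq_nonneg (p.2.2 0)) (sq_nonneg (p.2.2 1))) (sq_nonneg (v.2.2 2))]

/-- On a region `0 < r₁ ≤ r ≤ r₂` the derivative of `t⋆ - r` along a null vector bounds energy and
angular momentum. -/
theorem exists_energy_angMomentum_le (a : ℝ) {M r₁ r₂ : ℝ} (hM : 0 < M) (h₁ : 0 < r₁) :
    ∃ C, 0 < C ∧ ∀ p v : Amb, p.2.2 0 ^ 2 + p.2.2 1 ^ 2 + p.2.2 2 ^ 2 = 1 → r₁ ≤ p.2.1 →
      p.2.1 ≤ r₂ → metric a M p v v = 0 →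
      |energy a M p v| ≤ C * |v.1 - v.2.1| ∧ |angMomentum a M p v| ≤ C * |v.1 - v.2.1| := by
  -- The constant is the sum of the bounds, in units of `|σ|`, for the terms of `E = σ - k x` and `L
  -- = R b - a S (y + k x)`; here `4 M |r₂| / r₁²` bounds `k x` and `(r₂² + a²) / r₁` bounds `R b`.
  refine ⟨1 + (1 + |a|) * (4 * M * |r₂| / r₁ ^ 2) + (r₂ ^ 2 + a ^ 2) / r₁ + |a|, by positivity, ?_⟩
  intro p v hp hr1 hr2 hnull
  rw [metric_self_eq] at hnull
  rw [energy_eq, angMomentum_eq]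
  have hb := beta_sq_le p v
  set S := p.2.2 0 ^ 2 + p.2.2 1 ^ 2 with hS
  set W := v.2.2 0 ^ 2 + v.2.2 1 ^ 2 + v.2.2 2 ^ 2 with hW
  set R := rhoSq a p with hR
  set k := 2 * M * p.2.1 / R with hk
  set b := beta p v with hbv
  set x := v.1 - a * b with hx
  set y := v.2.1 - a * b with hy
  set σ := v.1 - v.2.1 with hσ
  have hr : 0 < p.2.1 := h₁.trans_le hr1
  have hS0 : 0 ≤ S := by positivity
  have hS1 : S ≤ 1 := by nlinarith [sq_nonneg (p.2.2 2)]
  have hW0 : 0 ≤ W := by positivity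
  have hR1 : r₁ ^ 2 ≤ R := by
    have : r₁ ^ 2 ≤ p.2.1 ^ 2 := by gcongr
    simp only [hR, rhoSq]; nlinarith [mul_nonneg (sq_nonneg a) (sq_nonneg (p.2.2 2))]
  have hR2 : R ≤ r₂ ^ 2 + a ^ 2 := by
    have : p.2.1 ^ 2 ≤ r₂ ^ 2 := by gcongr
    simp only [hR, rhoSq]; nlinarith [mul_nonneg (sq_nonneg a) hS0]
  have hR0 : 0 < R := lt_of_lt_of_le (by positivity) hR1
  clear_value S W R b
  clear_value k x y σ
  have hk0 : 0 ≤ k := by rw [hk]; positivity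
  clear hbv hR hp hS hW
  have hk1 : k ≤ 2 * M * |r₂| / r₁ ^ 2 := by
    have : p.2.1 ≤ |r₂| := hr2.trans (le_abs_self _)
    rw [hk]; gcongr
  -- Nullness reads `σ² = y² + k x² + R W` with every summand non-negative, so each is at most `σ²`.
  have hy1 : |y| ≤ |σ| := by
    apply sq_le_sq.1; linarith [mul_nonneg hk0 (sq_nonneg x), mul_nonneg hR0.le hW0]
  have hx1 : |x| ≤ 2 * |σ| := by
    have : x = σ + y := by simp only [hx, hσ, hy]; ring
    rw [this]; linarith [abs_add_le σ y]
  have hb1 : r₁ * |b| ≤ |σ| := by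
    rw [← abs_of_pos h₁, ← abs_mul]
    apply sq_le_sq.1
    have h1 : b ^ 2 ≤ W := hb.trans (mul_le_of_le_one_left hW0 hS1)
    have h2 : r₁ ^ 2 * b ^ 2 ≤ R * W := by gcongr
    rw [mul_pow]
    linarith [mul_nonneg hk0 (sq_nonneg x), sq_nonneg y]
  have hb2 : |b| ≤ |σ| / r₁ := by rw [le_div_iff₀ h₁]; linarith
  have hkx : |k * x| ≤ 4 * M * |r₂| / r₁ ^ 2 * |σ| := by
    rw [abs_mul, abs_of_nonneg hk0]
    calc k * |x| ≤ (2 * M * |r₂| / r₁ ^ 2) * (2 * |σ|) := by gcongr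
      _ = _ := by ring
  have hRb : |R * b| ≤ (r₂ ^ 2 + a ^ 2) / r₁ * |σ| := by
    rw [abs_mul, abs_of_pos hR0]
    calc R * |b| ≤ (r₂ ^ 2 + a ^ 2) * (|σ| / r₁) := by gcongr
      _ = _ := by ring
  set q := 4 * M * |r₂| / r₁ ^ 2 with hq
  have hq0 : 0 ≤ q := by positivity
  have hc0 : 0 ≤ (r₂ ^ 2 + a ^ 2) / r₁ := by positivity
  have ha0 := abs_nonneg a
  have hσ0 := abs_nonneg σ
  have hexp : (1 + (1 + |a|) * q + (r₂ ^ 2 + a ^ 2) / r₁ + |a|) * |σ| = |σ| + q * |σ|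
      + |a| * q * |σ| + (r₂ ^ 2 + a ^ 2) / r₁ * |σ| + |a| * |σ| := by ring
  rw [hexp]
  have i1 := mul_nonneg (mul_nonneg ha0 hq0) hσ0
  have i2 := mul_nonneg hc0 hσ0
  have i3 := mul_nonneg ha0 hσ0
  have i4 := mul_nonneg hq0 hσ0
  constructor
  · linarith [abs_sub σ (k * x)]
  · have h1 := abs_sub (R * b) (a * S * (y + k * x))
    have h2 : |a * S * (y + k * x)| ≤ |a| * (|σ| + q * |σ|) := by
      rw [abs_mul, abs_mul, abs_of_nonneg hS0]
      have h3 : |y + k * x| ≤ |σ| + q * |σ| := (abs_add_le _ _).trans (add_le_add hy1 hkx)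
      calc |a| * S * |y + k * x| ≤ |a| * 1 * (|σ| + q * |σ|) := by gcongr
        _ = _ := by ring
    linarith

/-- Off the horizons, where `Δ > 0` and `r > 0`, a null vector of vanishing energy and angular
momentum is zero. -/
theorem eq_zero_of_energy_angMomentum {a M : ℝ} {p v : Amb}
    (hp : p.2.2 0 ^ 2 + p.2.2 1 ^ 2 + p.2.2 2 ^ 2 = 1) (hr : 0 < p.2.1)
    (hΔ : 0 < Delta a M p.2.1) (hnull : metric a M p v v = 0) (hE : energy a M p v = 0)
    (hL : angMomentum a M p v = 0) : v = 0 := by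
  rw [metric_self_eq] at hnull
  rw [energy_eq] at hE
  rw [angMomentum_eq] at hL
  have hb := beta_sq_le p v
  have hR0 : 0 < rhoSq a p := by unfold rhoSq; positivity
  have hRk : 2 * M * p.2.1 / rhoSq a p * rhoSq a p = 2 * M * p.2.1 := by field_simp
  have hΔ' : Delta a M p.2.1 = rhoSq a p + a ^ 2 * (p.2.2 0 ^ 2 + p.2.2 1 ^ 2)
      - 2 * M * p.2.1 := by
    simp only [Delta, rhoSq]; linear_combination (-a ^ 2) * hp
  set S := p.2.2 0 ^ 2 + p.2.2 1 ^ 2 with hS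
  set W := v.2.2 0 ^ 2 + v.2.2 1 ^ 2 + v.2.2 2 ^ 2 with hW
  set R := rhoSq a p with hR
  set k := 2 * M * p.2.1 / R with hk
  have hbdef : beta p v = p.2.2 0 * v.2.2 1 - p.2.2 1 * v.2.2 0 := rfl
  set b := beta p v
  have hS0 : 0 ≤ S := by positivity
  have hW0 : 0 ≤ W := by positivity
  clear_value S W R b
  clear_value k
  obtain ⟨x, hx⟩ : ∃ x, x = v.1 - a * b := ⟨_, rfl⟩
  rw [← hx] at hnull hE hL
  have e1 : v.2.1 - a * b = (1 - k) * x := by linear_combination -hE - hx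
  have e2 : R * b = a * S * x := by
    rw [e1] at hL; linear_combination hL
  have e3 : (1 - k) * x ^ 2 + R * W = 0 := by
    rw [e1] at hnull
    have : v.1 - v.2.1 = k * x := by linarith
    rw [this] at hnull
    linear_combination hnull
  have e4 : a ^ 2 * S * x ^ 2 ≤ R ^ 2 * W := by
    -- On the axis `S = 0` and the left side vanishes; elsewhere `S` can be cancelled.
    rcases hS0.eq_or_lt with h0 | h0
    · rw [← h0]; simp; positivity
    · refine le_of_mul_le_mul_left ?_ h0
      calc S * (a ^ 2 * S * x ^ 2) = (R * b) ^ 2 := by rw [e2]; ring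
        _ = R ^ 2 * b ^ 2 := by ring
        _ ≤ R ^ 2 * (S * W) := by gcongr
        _ = _ := by ring
  -- Since `Δ = R (1 - k) + a² S`, multiplying `e3` by `R` gives `Δ x² = a² S x² - R² W`, and `e4`
  -- applies.
  have e5 : Delta a M p.2.1 * x ^ 2 ≤ 0 := by
    rw [hΔ', ← hRk]
    nlinarith
  have hx0 : x = 0 := by
    have : x ^ 2 ≤ 0 := by
      by_contra hc
      exact absurd e5 (not_le.2 (mul_pos hΔ (not_le.1 hc)))
    exact pow_eq_zero_iff (two_ne_zero) |>.1 (le_antisymm this (sq_nonneg x))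
  have hWz : W = 0 := by
    rw [hx0] at e3; simpa [hR0.ne'] using e3
  have w0 : v.2.2 0 = 0 := by
    refine pow_eq_zero_iff two_ne_zero |>.1 ?_
    linarith [sq_nonneg (v.2.2 0), sq_nonneg (v.2.2 1), sq_nonneg (v.2.2 2)]
  have w1 : v.2.2 1 = 0 := by
    refine pow_eq_zero_iff two_ne_zero |>.1 ?_
    linarith [sq_nonneg (v.2.2 0), sq_nonneg (v.2.2 1), sq_nonneg (v.2.2 2)]
  have w2 : v.2.2 2 = 0 := by
    refine pow_eq_zero_iff two_ne_zero |>.1 ?_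
    linarith [sq_nonneg (v.2.2 0), sq_nonneg (v.2.2 1), sq_nonneg (v.2.2 2)]
  have hb0 : b = 0 := by rw [hbdef, w0, w1]; ring
  rw [hb0, hx0] at hx
  rw [hb0, hx0] at e1
  refine Prod.ext (by simp; linarith) (Prod.ext (by simp; linarith) ?_)
  ext i
  fin_cases i
  · exact w0
  · exact w1
  · exact w2

/-! ### Unboundedness of a function with derivative away from zero, and the conclusion. -/

/-- A function on `[0, ∞)` whose derivative is continuous and bounded away from zero is
unbounded. -/
theorem unbounded_of_le_abs_deriv {f f' : ℝ → ℝ} {c : ℝ} (hc : 0 < c)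
    (hf : ∀ s ∈ Set.Ici (0 : ℝ), HasDerivWithinAt f (f' s) (Set.Ici 0) s)
    (hf' : ContinuousOn f' (Set.Ici 0)) (hle : ∀ s ∈ Set.Ici (0 : ℝ), c ≤ |f' s|) (B : ℝ) :
    ∃ s ∈ Set.Ici (0 : ℝ), B < |f s| := by
  -- A continuous derivative that never vanishes keeps its sign, so up to replacing `f` by `-f` it
  -- is at least `c` throughout.
  wlog hpos : 0 < f' 0 generalizing f f'
  · have h0 := hle 0 Set.self_mem_Ici
    have hneg : 0 < -f' 0 := by
      rcases lt_trichotomy (f' 0) 0 with h | h | h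
      · linarith
      · rw [h, abs_zero] at h0; linarith
      · exact absurd h hpos
    obtain ⟨s, hs, h⟩ := this (f := fun s => -f s) (f' := fun s => -f' s)
      (fun s hs => (hf s hs).neg) hf'.neg (fun s hs => by simpa using hle s hs) hneg
    exact ⟨s, hs, by simpa using h⟩
  have hall : ∀ s ∈ Set.Ici (0 : ℝ), c ≤ f' s := by
    intro s hs
    have hp : 0 < f' s := by
      by_contra hn
      obtain ⟨t, ht, ht0⟩ := (isPreconnected_Ici (a := (0 : ℝ))).intermediate_value hs
        Set.self_mem_Ici hf' ⟨not_lt.1 hn, hpos.le⟩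
      have := hle t ht
      rw [ht0, abs_zero] at this
      linarith
    simpa [abs_of_pos hp] using hle s hs
  -- By this parameter `f` has grown by at least `|B| + |f 0| + 1`, which beats both `B` and a
  -- negative initial value.
  have hs : (0 : ℝ) ≤ (|B| + |f 0| + 1) / c := by positivity
  refine ⟨(|B| + |f 0| + 1) / c, hs, ?_⟩
  have h := (convex_Ici (0 : ℝ)).mul_sub_le_image_sub_of_le_deriv
    (fun s hs => (hf s hs).continuousWithinAt)
    (fun s hs => ((hf s (interior_subset hs)).mono interior_subset).differentiableWithinAt)
    (C := c) (fun s hs => by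
      rw [interior_Ici] at hs
      rw [((hf s (Set.mem_Ici.2 (le_of_lt hs))).hasDerivAt (Ici_mem_nhds hs)).deriv]
      exact hall s (Set.mem_Ici.2 (le_of_lt hs)))
    0 Set.self_mem_Ici _ hs hs
  rw [sub_zero, mul_div_cancel₀ _ hc.ne'] at h
  have := neg_abs_le (f 0)
  have := le_abs_self B
  exact lt_of_lt_of_le (by linarith) (le_abs_self _)

theorem Delta_eq_mul {a M : ℝ} (h : |a| < M) (r : ℝ) :
    Delta a M r = (r - rMinus a M) * (r - rPlus a M) := by
  have h1 : 0 ≤ M ^ 2 - a ^ 2 := by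
    have := sq_lt_sq' (by linarith [abs_nonneg a]) h
    rw [sq_abs] at this; linarith
  simp only [Delta, rMinus, rPlus]
  linear_combination Real.sq_sqrt h1

end Kerr
end

/-- The function `t⋆ - r` has timelike gradient where `r > 0`, and its derivative along the ray is
bounded away from zero by the conserved energy and angular momentum. Where moreover `Δ > 0`, the
latter cannot both vanish along a null geodesic, so that Carter's constant plays no role. -/
theorem mainTheorem6 (a M : ℝ) (ha : a ≠ 0) (haM : |a| < M)
    (γ : ℝ → Kerr.KerrStar a)
    (hgeo : Kerr.IsGeodesicOn M γ (Set.Ici 0))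
    (hnull : Kerr.IsNullOn M γ (Set.Ici 0))
    (hconst : ∃ s ∈ Set.Ici (0 : ℝ),
      Kerr.energy a M (γ s).pt (Kerr.velocity γ (Set.Ici 0) s) ≠ 0 ∨
      Kerr.angMomentum a M (γ s).pt (Kerr.velocity γ (Set.Ici 0) s) ≠ 0 ∨
      Kerr.carterK a M (γ s).pt (Kerr.velocity γ (Set.Ici 0) s) ≠ 0)
    (hr : ∃ C : Set ℝ, IsCompact C ∧
      (C ⊆ Set.Ioo 0 (Kerr.rMinus a M) ∨ C ⊆ Set.Ioi (Kerr.rPlus a M)) ∧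
      ∀ s ∈ Set.Ici (0 : ℝ), (γ s).radius ∈ C) :
    ¬ Kerr.IsBoundedOn γ (Set.Ici 0) := by
  open Kerr in
  rintro ⟨K, hK, hγK⟩
  obtain ⟨C, hC, hCsub, hrC⟩ := hr
  have hM : 0 < M := (abs_nonneg a).trans_lt haM
  have hsqrt := Real.sqrt_nonneg (M ^ 2 - a ^ 2)
  have hposΔ : ∀ r ∈ C, 0 < r ∧ 0 < Delta a M r := by
    intro r hr
    rw [Delta_eq_mul haM]
    have hle : rMinus a M ≤ rPlus a M := by unfold rMinus rPlus; linarith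
    -- In both regions the two factors of `Δ` have the same sign.
    rcases hCsub with h | h
    · have h1 := h hr
      exact ⟨h1.1, mul_pos_of_neg_of_neg (by linarith [h1.2]) (by linarith [h1.2])⟩
    · have h1 : rPlus a M < r := h hr
      refine ⟨?_, mul_pos (by linarith) (by linarith)⟩
      unfold rPlus at h1; linarith
  have hne : C.Nonempty := ⟨_, hrC 0 Set.self_mem_Ici⟩
  obtain ⟨r₁, hr₁, hmin⟩ := hC.exists_isLeast hne
  obtain ⟨r₂, hr₂, hmax⟩ := hC.exists_isGreatest hne
  obtain ⟨c, hc, hbound⟩ := exists_energy_angMomentum_le a (r₂ := r₂) hM (hposΔ r₁ hr₁).1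
  have hI : UniqueDiffOn ℝ (Set.Ici (0 : ℝ)) := uniqueDiffOn_Ici 0
  have hE : ∀ s ∈ Set.Ici (0 : ℝ), _ := fun s hs =>
    eq_zero_of_hasDerivWithinAt_zero (fun t ht => hgeo.hasDerivWithinAt_energy hI ht) hs
  have hL : ∀ s ∈ Set.Ici (0 : ℝ), _ := fun s hs =>
    eq_zero_of_hasDerivWithinAt_zero (fun t ht => hgeo.hasDerivWithinAt_angMomentum hI ht) hs
  set E := energy a M (γ 0).pt (velocity γ (Set.Ici 0) 0) with hEdef
  set L := angMomentum a M (γ 0).pt (velocity γ (Set.Ici 0) 0) with hLdef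
  have hm : 0 < max |E| |L| := by
    by_contra hcon
    have h1 : |E| ≤ 0 := (le_max_left _ _).trans (not_lt.1 hcon)
    have h2 : |L| ≤ 0 := (le_max_right _ _).trans (not_lt.1 hcon)
    have h0 := hposΔ _ (hrC 0 Set.self_mem_Ici)
    exact (hnull 0 Set.self_mem_Ici).1 (eq_zero_of_energy_angMomentum (sphere_sq_sum (γ 0)) h0.1
      h0.2 (hnull 0 Set.self_mem_Ici).2 (abs_nonpos_iff.1 h1) (abs_nonpos_iff.1 h2))
  have hvel : ∀ s ∈ Set.Ici (0 : ℝ), HasDerivWithinAt (fun t => (γ t).pt)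
      (velocity γ (Set.Ici 0) s) (Set.Ici 0) s := fun s hs =>
    ((hgeo.1 s hs).differentiableWithinAt (by norm_num)).hasDerivWithinAt
  have hvelc : ContinuousOn (velocity γ (Set.Ici 0)) (Set.Ici 0) :=
    hgeo.1.continuousOn_derivWithin hI (by norm_num)
  obtain ⟨B, hB⟩ := hK.exists_bound_of_continuousOn (f := fun q : KerrStar a => q.pt.1 - q.pt.2.1)
    (by unfold KerrStar.pt amb; fun_prop)
  obtain ⟨s, hs, hlt⟩ := unbounded_of_le_abs_deriv (f := fun t => (γ t).pt.1 - (γ t).pt.2.1)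
    (f' := fun t => (velocity γ (Set.Ici 0) t).1 - (velocity γ (Set.Ici 0) t).2.1)
    -- Conservation of `E` and `L` makes the pointwise bound uniform along the ray: `max |E| |L| ≤ c
    -- |σ|` at every parameter.
    (c := max |E| |L| / c) (by positivity)
    (fun s hs => by
      have h := (hvel s hs).hasFDerivWithinAt
      exact (h.fst.hasDerivWithinAt.sub h.snd.fst.hasDerivWithinAt).congr_deriv (by simp))
    (by fun_prop)
    (fun s hs => by
      have h := hbound (γ s).pt (velocity γ (Set.Ici 0) s) (sphere_sq_sum _)
        (hmin (hrC s hs)) (hmax (hrC s hs)) (hnull s hs).2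
      rw [hE s hs, hL s hs] at h
      rw [div_le_iff₀ hc, mul_comm]
      exact max_le h.1 h.2) B
  exact absurd (hB _ (hγK s hs)) (not_le.2 hlt)
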